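/- Let $n\ge 0$. For $\nu>0$ let $W_2^{\nu}(\mathbb R^{N})$ be the space of $u\in L_2(\mathbb R^{N})$ such that $|\xi|^{\nu}\mathcal F[u](\xi)$ is square integrable, where $\mathcal F$ is the Fourier transform on $L_2(\mathbb R^N)$, and put $\mathcal V(\mathbb R^{2n})=W_2^{n+1}(\mathbb R^{2n})\cap\mathcal F[W_2^{n+1}(\mathbb R^{2n})]$. For a kernel $\rho(q,q')$, $q,q'\in\mathbb R^n$, in $\mathcal V(\mathbb R^{2n})$ define the characteristic function and the optical tomogram $$f_\rho(x,y)=\int_{\mathbb R^n}e^{ix\cdot t}\rho\left(t+\tfrac y2,\,t-\tfrac y2\right)dt,\qquad \omega_\rho(x,\alpha)=\frac1{(2\pi)^n}\int_{\mathbb R^n}e^{-ix\cdot t}f_\rho\big((t_j\cos\alpha_j)_j,(t_j\sin\alpha_j)_j\big)\,dt .$$ Let $\rho_1,\rho_2\in\mathcal V(\mathbb R^{2n})$ be complex-valued kernels (no positivity or Hermiticity is required). Then the transition probability $$P_{12}=\int_{\mathbb R^{2n}}\rho_1(q,q')\rho_2(q',q)\,dq\,dq'$$ satisfies $$P_{12}=\frac1{(2\pi)^n}\int_{[0,\pi]^n\times\mathbb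 R^n}\Big(\prod_{j=1}^n|\lambda_j|\Big)\left(\int_{\mathbb R^{2n}}e^{i\lambda\cdot(x-x')}\,\omega_{\rho_1}(x,\alpha)\,\omega_{\rho_2}(x',\alpha)\,dx\,dx'\right)d\alpha\,d\lambda .$$ Here all the integrals converge absolutely: those for $P_{12}$ and over $[0,\pi]^n\times\mathbb R^n$; the one for $f_{\rho_i}(x,y)$ for almost every $y$ and all $x$; the one for $\omega_{\rho_i}(x,\alpha)$ for almost every $\alpha$ and all $x$; and the inner one for almost every $\alpha$ and all $\lambda$. This holds for every choice of representatives of $\rho_1,\rho_2$. -/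

import Mathlib

open MeasureTheory FourierTransform
open scoped Real

noncomputable section

/-- `u ∈ L²(ℝ^ι)` belongs to the Sobolev space `W₂^ν(ℝ^ι)` when `|ξ|^ν 𝓕[u](ξ)` is square
integrable, `𝓕` being the Fourier transform on `L²`. The normalization of `𝓕` (here
`∫ e^{-2πi x·ξ} u(x) dx`) only dilates and rescales `𝓕[u]`, so it does not affect this space. -/
def MemW {ι : Type} [Fintype ι] (ν : ℕ)
    (u : Lp ℂ 2 (volume : Measure (EuclideanSpace ℝ ι))) : Prop :=
  MemLp (fun ξ : EuclideanSpace ℝ ι =>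
    ((‖ξ‖ ^ ν : ℝ) : ℂ) * (𝓕 u : Lp ℂ 2 (volume : Measure (EuclideanSpace ℝ ι))) ξ) 2 volume

/-- A kernel `ρ(q, q')` on `ℝⁿ × ℝⁿ`, seen as a function on the Euclidean space `ℝ²ⁿ`. -/
def kernelFun {n : ℕ} (ρ : (Fin n → ℝ) → (Fin n → ℝ) → ℂ)
    (z : EuclideanSpace ℝ (Fin n ⊕ Fin n)) : ℂ :=
  ρ (fun j => z (Sum.inl j)) (fun j => z (Sum.inr j))

/-- `ρ` is (a representative of) an element of
`𝒱(ℝ²ⁿ) = W₂^{n+1}(ℝ²ⁿ) ∩ 𝓕[W₂^{n+1}(ℝ²ⁿ)]`. Since `W₂^{n+1}` is invariant under dilations and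
scalar multiples, the image under `𝓕` does not depend on the normalization of `𝓕` either. -/
def MemV {n : ℕ} (ρ : (Fin n → ℝ) → (Fin n → ℝ) → ℂ) : Prop :=
  ∃ h : MemLp (kernelFun ρ) 2 volume,
    MemW (n + 1) (h.toLp (kernelFun ρ)) ∧
    ∃ g : Lp ℂ 2 (volume : Measure (EuclideanSpace ℝ (Fin n ⊕ Fin n))),
      MemW (n + 1) g ∧ 𝓕 g = h.toLp (kernelFun ρ)

/-- The character `e^{i x·t}` on `ℝⁿ`. -/
def expI {n : ℕ} (x t : Fin n → ℝ) : ℂ :=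
  Complex.exp (Complex.I * ((∑ j, x j * t j : ℝ) : ℂ))

/-- The point `(t₁ cos α₁, …, tₙ cos αₙ)`. -/
def mulCos {n : ℕ} (t α : Fin n → ℝ) : Fin n → ℝ := fun j => t j * Real.cos (α j)

/-- The point `(t₁ sin α₁, …, tₙ sin αₙ)`. -/
def mulSin {n : ℕ} (t α : Fin n → ℝ) : Fin n → ℝ := fun j => t j * Real.sin (α j)

/-- The characteristic function
`f_ρ(x, y) = ∫ e^{i x·t} ρ(t + y/2, t - y/2) dt`. -/
def charFn {n : ℕ} (ρ : (Fin n → ℝ) → (Fin n → ℝ) → ℂ) (x y : Fin n → ℝ) : ℂ :=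
  ∫ t : Fin n → ℝ, expI x t * ρ (t + (1 / 2 : ℝ) • y) (t - (1 / 2 : ℝ) • y)

/-- The optical tomogram
`ω_ρ(x, α) = (2π)⁻ⁿ ∫ e^{-i x·t} f_ρ(t cos α, t sin α) dt`. -/
def tomogram {n : ℕ} (ρ : (Fin n → ℝ) → (Fin n → ℝ) → ℂ) (x α : Fin n → ℝ) : ℂ :=
  (1 / (2 * (π : ℂ)) ^ n) *
    ∫ t : Fin n → ℝ, expI (-x) t * charFn ρ (mulCos t α) (mulSin t α)

/-- The transition probability `P₁₂ = ∫ ρ₁(q, q') ρ₂(q', q) dq dq'`. -/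
def transProb {n : ℕ} (ρ₁ ρ₂ : (Fin n → ℝ) → (Fin n → ℝ) → ℂ) : ℂ :=
  ∫ p : (Fin n → ℝ) × (Fin n → ℝ), ρ₁ p.1 p.2 * ρ₂ p.2 p.1

/-- The cube `[0, π]ⁿ`. -/
def angleBox (n : ℕ) : Set (Fin n → ℝ) := Set.Icc (fun _ => 0) (fun _ => π)

/-- The inner integrand `e^{i l·(x - x')} ω_{ρ₁}(x, α) ω_{ρ₂}(x', α)`, as a function of
`p = (x, x')`. -/
def pairIntegrand {n : ℕ} (ρ₁ ρ₂ : (Fin n → ℝ) → (Fin n → ℝ) → ℂ) (α l : Fin n → ℝ)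
    (p : (Fin n → ℝ) × (Fin n → ℝ)) : ℂ :=
  expI l (p.1 - p.2) * tomogram ρ₁ p.1 α * tomogram ρ₂ p.2 α

/-- The outer integrand `∏ |l_j| ∫ e^{i l·(x - x')} ω_{ρ₁}(x, α) ω_{ρ₂}(x', α) dx dx'`, as a
function of `a = (α, l)`. -/
def outerIntegrand {n : ℕ} (ρ₁ ρ₂ : (Fin n → ℝ) → (Fin n → ℝ) → ℂ)
    (a : (Fin n → ℝ) × (Fin n → ℝ)) : ℂ :=
  ((∏ j, |a.2 j| : ℝ) : ℂ) * ∫ p, pairIntegrand ρ₁ ρ₂ a.1 a.2 p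

/-- The integrals which define the tomogram of `ρ` converge absolutely: the one for `f_ρ(x, y)`
for almost every `y` (and then every `x`), the one for `ω_ρ(x, α)` for almost every `α` (and then
every `x`). Both integrability conditions are free of `x`, as the characters have modulus `1`. -/
def TomogramConverges {n : ℕ} (ρ : (Fin n → ℝ) → (Fin n → ℝ) → ℂ) : Prop :=
  (∀ᵐ y : Fin n → ℝ, Integrable fun t : Fin n → ℝ =>
    ρ (t + (1 / 2 : ℝ) • y) (t - (1 / 2 : ℝ) • y)) ∧
  ∀ᵐ α : Fin n → ℝ, Integrable fun t : Fin n → ℝ => charFn ρ (mulCos t α) (mulSin t α)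

end

/-!
The formula is Parseval's identity for the characteristic function, written in polar coordinates.
Let `r(t, y) = ρ(t + y/2, t - y/2)` and let `W(t, p) = (2π)⁻ⁿ ∫ e^{-i p·y} r(t, y) dy` be its Wigner
function. The Fourier transform `f` of `W` on `ℝ²ⁿ` is the characteristic function of `ρ`, so on the
`n`-plane at angle `α` it is the Fourier transform of the marginal `W_α` of `W` along the orthogonal
plane (`Admissible.ft_marginal`), and by Fourier inversion the tomogram `ω(·, α)` is that marginal
(`MemV.tomogram_ae_eq`). The inner integral of the theorem is therefore
`f₁(l cos α, l sin α) f₂(-l cos α, -l sin α)`. As `∏ |l j|` is the Jacobian of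
`(α, l) ↦ (l cos α, l sin α)`, which covers `ℝ²ⁿ` once up to a null set (`setIntegral_polarMap`),
the outer integral is `∫ f₁(z) f₂(-z) dz`, and Parseval's identity in the first block of variables
gives `(2π)ⁿ P₁₂` (`MemV.integral_ft2_wigner_mul`).

The analytic content is the absolute convergence, in particular the integrability of
`t ↦ f(t cos α, t sin α)` on `ℝⁿ`. All of it comes from one stability property. Call `H` on
`ℝ²ⁿ` admissible when `(1 + |z|)^{n+1} H` and `(1 + |ζ|)^{n+1} 𝓕H` are square integrable; this is
membership in `𝒱(ℝ²ⁿ)`, it implies `H ∈ L¹` because `2(n+1) > 2n`, and it is invariant under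
rotations. If `H` is admissible then its partial Fourier transform `G(x, b)` in the first `n`
variables decays in the same way (`Decay.pft`): Plancherel's identity in the first block carries
over the decay in `b`, and Plancherel's identity in the second block carries over the decay in `x`
from that of `𝓕H`. Hence
`G ∈ L¹(ℝ²ⁿ)`, so `x ↦ ∫ G(x, b) db = 𝓕H(x, 0)` is integrable: the transform of an admissible
function is integrable on the plane `y = 0`, and, after a rotation, on the plane at any angle `α`
(`Admissible.integrable_ft_marginal`). The same property shows that `W` and `f` decay.

The representative of `ρ` only matters for a null set of `y`, and this set meets the plane at angle
`α` in a null set as soon as no `sin (α j)` vanishes (`MemV.charFn_slice_ae_eq`).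
-/

noncomputable section

/-! ### Fourier inversion and Plancherel's identity on `L¹ ∩ L²` -/

section InnerProduct

variable {V : Type*} [NormedAddCommGroup V] [InnerProductSpace ℝ V] [MeasurableSpace V]
  [BorelSpace V] [FiniteDimensional ℝ V]

lemma integral_fourier_mul_eq {f g : V → ℂ} (hf : Integrable f) (hg : Integrable g) :
    ∫ x, 𝓕 f x * g x = ∫ x, f x * 𝓕 g x := by
  have := VectorFourier.integral_fourierIntegral_smul_eq_flip (L := innerₗ V) (μ := volume)
    (ν := volume) Real.continuous_fourierChar continuous_inner hf hg
  simpa using! this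

lemma integral_fourierInv_mul_eq {f g : V → ℂ} (hf : Integrable f) (hg : Integrable g) :
    ∫ x, 𝓕⁻ f x * g x = ∫ x, f x * 𝓕⁻ g x := by
  have := integral_fourier_mul_eq hf hg.comp_neg
  rw [← Real.fourierInv_eq_fourier_comp_neg] at this
  rw [← this, ← integral_neg_eq_self]
  simp [Real.fourierInv_eq_fourier_neg]

lemma continuous_fourier_of_integrable {f : V → ℂ} (hf : Integrable f) : Continuous (𝓕 f) :=
  VectorFourier.fourierIntegral_continuous (L := innerₗ V) Real.continuous_fourierChar
    continuous_inner hf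

/-- Two locally integrable functions which agree as tempered distributions agree almost
everywhere. -/
lemma ae_eq_of_integral_schwartz_mul_eq {f g : V → ℂ} (hf : LocallyIntegrable f)
    (hg : LocallyIntegrable g)
    (h : ∀ φ : SchwartzMap V ℂ, ∫ x, φ x * f x = ∫ x, φ x * g x) : f =ᵐ[volume] g := by
  refine ae_eq_of_integral_contDiff_smul_eq hf hg fun φ hφ hc => ?_
  have h₁ : HasCompactSupport (Complex.ofRealCLM ∘ φ) := hc.comp_left rfl
  have h₂ : ContDiff ℝ (↑(⊤ : ℕ∞)) (Complex.ofRealCLM ∘ φ) := by fun_prop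
  simpa using h (h₁.toSchwartzMap h₂)

/-- On `L¹ ∩ L²` the Fourier transform of `L²` is given by the Fourier integral. -/
lemma fourier_toLp_ae_eq {u : V → ℂ} (hu : Integrable u) (h : MemLp u 2 volume) :
    (𝓕 (h.toLp u) : Lp ℂ 2 (volume : Measure V)) =ᵐ[volume] 𝓕 u := by
  refine ae_eq_of_integral_schwartz_mul_eq ?_ ?_ fun φ => ?_
  · exact (Lp.memLp _).locallyIntegrable (by norm_num)
  · exact (continuous_fourier_of_integrable hu).locallyIntegrable
  · have h1 := congrArg (fun T => T φ) (Lp.fourier_toTemperedDistribution_eq (h.toLp u))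
    simp only [TemperedDistribution.fourier_apply, Lp.toTemperedDistribution_apply,
      smul_eq_mul] at h1
    rw [← h1]
    have h2 := integral_fourier_mul_eq φ.integrable hu
    rw [← SchwartzMap.fourier_coe] at h2
    rw [← h2]
    refine integral_congr_ae ?_
    filter_upwards [h.coeFn_toLp] with x hx
    rw [hx]

/-- Fourier inversion, almost everywhere, without continuity assumption. -/
lemma fourierInv_fourier_ae_eq {f : V → ℂ} (hf : Integrable f) (hf' : Integrable (𝓕 f)) :
    𝓕⁻ (𝓕 f) =ᵐ[volume] f := by
  refine ae_eq_of_integral_schwartz_mul_eq ?_ hf.locallyIntegrable fun φ => ?_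
  · rw [Real.fourierInv_eq_fourier_comp_neg]
    exact (continuous_fourier_of_integrable hf'.comp_neg).locallyIntegrable
  · calc ∫ x, φ x * 𝓕⁻ (𝓕 f) x = ∫ x, 𝓕⁻ (φ : V → ℂ) x * 𝓕 f x :=
          (integral_fourierInv_mul_eq φ.integrable hf').symm
      _ = ∫ x, 𝓕 (𝓕⁻ (φ : V → ℂ)) x * f x := by
          rw [← SchwartzMap.fourierInv_coe]
          exact (integral_fourier_mul_eq (𝓕⁻ φ).integrable hf).symm
      _ = ∫ x, φ x * f x := by
          rw [← SchwartzMap.fourierInv_coe, ← SchwartzMap.fourier_coe]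
          simp

lemma memLp_fourier {f : V → ℂ} (hf : Integrable f) (h : MemLp f 2 volume) :
    MemLp (𝓕 f) 2 volume :=
  (memLp_congr_ae (fourier_toLp_ae_eq hf h)).1 (Lp.memLp _)

lemma eLpNorm_fourier {f : V → ℂ} (hf : Integrable f) (h : MemLp f 2 volume) :
    eLpNorm (𝓕 f) 2 volume = eLpNorm f 2 volume := by
  rw [← eLpNorm_congr_ae (fourier_toLp_ae_eq hf h), ← eLpNorm_congr_ae h.coeFn_toLp,
    ← Lp.enorm_def, ← Lp.enorm_def, ← ofReal_norm, ← ofReal_norm, Lp.norm_fourier_eq]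

lemma integral_fourier_mul_conj {f g : V → ℂ} (hf : Integrable f) (hf2 : MemLp f 2 volume)
    (hg : Integrable g) (hg2 : MemLp g 2 volume) :
    ∫ x, 𝓕 f x * starRingEnd ℂ (𝓕 g x) = ∫ x, f x * starRingEnd ℂ (g x) := by
  have h := Lp.inner_fourier_eq (hg2.toLp g) (hf2.toLp f)
  rw [L2.inner_def, L2.inner_def] at h
  simp only [RCLike.inner_apply] at h
  calc _ = _ := integral_congr_ae ?_
    _ = _ := h
    _ = _ := integral_congr_ae ?_
  · filter_upwards [fourier_toLp_ae_eq hf hf2, fourier_toLp_ae_eq hg hg2] with x h1 h2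
    rw [h1, h2]
  · filter_upwards [hf2.coeFn_toLp, hg2.coeFn_toLp] with x h1 h2
    rw [h1, h2]

lemma fourier_conj (g : V → ℂ) (x : V) :
    𝓕 (fun v => starRingEnd ℂ (g v)) x = starRingEnd ℂ (𝓕 g (-x)) := by
  rw [Real.fourier_eq', Real.fourier_eq', ← integral_conj]
  congr 1 with v
  simp [← Complex.exp_conj, Complex.conj_ofNat]

/-- The bilinear form of Parseval's identity. -/
lemma integral_fourier_mul_fourier_neg {f g : V → ℂ} (hf : Integrable f) (hf2 : MemLp f 2 volume)
    (hg : Integrable g) (hg2 : MemLp g 2 volume) :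
    ∫ x, 𝓕 f x * 𝓕 g (-x) = ∫ x, f x * g x := by
  have hc : Integrable fun v => starRingEnd ℂ (g v) := by
    refine ⟨Complex.continuous_conj.comp_aestronglyMeasurable hg.1, ?_⟩
    simpa [HasFiniteIntegral] using hg.2
  have := integral_fourier_mul_conj hf hf2 hc hg2.star
  simpa [fourier_conj] using this

end InnerProduct

/-! ### The Fourier integral on `ℝⁿ` without `2π` in the exponent -/

section Coordinates

variable {n : ℕ}

/-- The Fourier integral `∫ e^{i x·t} g(t) dt` on `ℝⁿ`, in the normalization of the characteristic
function. -/
def ft (g : (Fin n → ℝ) → ℂ) (x : Fin n → ℝ) : ℂ := ∫ t, expI x t * g t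

lemma norm_expI (x t : Fin n → ℝ) : ‖expI x t‖ = 1 := by
  rw [expI, mul_comm, Complex.norm_exp_ofReal_mul_I]

@[fun_prop]
lemma Continuous.expI {X : Type*} [TopologicalSpace X] {f g : X → Fin n → ℝ} (hf : Continuous f)
    (hg : Continuous g) : Continuous fun z => expI (f z) (g z) := by
  unfold _root_.expI
  fun_prop

lemma expI_add_right (x s t : Fin n → ℝ) : expI x (s + t) = expI x s * expI x t := by
  simp [expI, ← Complex.exp_add, mul_add, Finset.sum_add_distrib]

lemma expI_neg_right (x t : Fin n → ℝ) : expI x (-t) = expI (-x) t := by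
  simp [expI]

lemma MeasureTheory.Integrable.expI_mul {X : Type*} [TopologicalSpace X]
    [SecondCountableTopology X] [MeasurableSpace X] [OpensMeasurableSpace X] {μ : Measure X}
    {f g : X → Fin n → ℝ} {h : X → ℂ} (hh : Integrable h μ) (hf : Continuous f)
    (hg : Continuous g) :
    Integrable (fun z => expI (f z) (g z) * h z) μ :=
  hh.bdd_mul (hf.expI hg).aestronglyMeasurable (c := 1) (ae_of_all _ fun _ => (norm_expI _ _).le)

lemma ft_congr_ae {g h : (Fin n → ℝ) → ℂ} (e : g =ᵐ[volume] h) : ft g = ft h := by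
  ext x
  refine integral_congr_ae ?_
  filter_upwards [e] with t ht
  rw [ht]

lemma continuous_ft {g : (Fin n → ℝ) → ℂ} (hg : Integrable g) : Continuous (ft g) := by
  refine continuous_of_dominated (bound := fun t => ‖g t‖) (fun x => ?_) (fun x => ?_) hg.norm ?_
  · exact (Integrable.expI_mul hg continuous_const continuous_id).1
  · exact ae_of_all _ fun t => by rw [norm_mul, norm_expI, one_mul]
  · exact ae_of_all _ fun t => by fun_prop

/-- The change of normalization between `ft` and Mathlib's Fourier transform. -/
lemma fourier_comp_ofLp (g : (Fin n → ℝ) → ℂ) (w : EuclideanSpace ℝ (Fin n)) :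
    𝓕 (fun v : EuclideanSpace ℝ (Fin n) => g v.ofLp) w = ft g (-(2 * π) • w.ofLp) := by
  rw [Real.fourier_eq', ft, ← (PiLp.volume_preserving_ofLp (Fin n)).integral_comp
    (MeasurableEquiv.toLp 2 (Fin n → ℝ)).symm.measurableEmbedding]
  congr 1 with v
  rw [smul_eq_mul, expI]
  congr 2
  simp only [PiLp.inner_apply, RCLike.inner_apply, conj_trivial, Pi.smul_apply, smul_eq_mul]
  push_cast
  rw [Finset.mul_sum, Finset.mul_sum, Finset.sum_mul]
  exact Finset.sum_congr rfl fun j _ => by ring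

lemma integrable_comp_ofLp {g : (Fin n → ℝ) → ℂ} :
    Integrable (fun v : EuclideanSpace ℝ (Fin n) => g v.ofLp) ↔ Integrable g :=
  (PiLp.volume_preserving_ofLp (Fin n)).integrable_comp_emb
    (MeasurableEquiv.toLp 2 (Fin n → ℝ)).symm.measurableEmbedding

lemma memLp_comp_ofLp {g : (Fin n → ℝ) → ℂ} (hg : MemLp g 2 volume) :
    MemLp (fun v : EuclideanSpace ℝ (Fin n) => g v.ofLp) 2 volume :=
  hg.comp_measurePreserving (PiLp.volume_preserving_ofLp (Fin n))

/-- Rescaling a frequency integral from Mathlib's normalization to that of `ft`. -/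
lemma integral_comp_two_pi_smul_ofLp (F : (Fin n → ℝ) → ℂ) :
    ∫ w : EuclideanSpace ℝ (Fin n), F (-(2 * π) • w.ofLp) =
      (1 / (2 * (π : ℂ)) ^ n) * ∫ x, F x := by
  rw [(PiLp.volume_preserving_ofLp (Fin n)).integral_comp
    (MeasurableEquiv.toLp 2 (Fin n → ℝ)).symm.measurableEmbedding (fun x => F (-(2 * π) • x)),
    Measure.integral_comp_smul]
  simp [abs_of_pos Real.pi_pos]

/-- Fourier inversion for `ft`. -/
lemma ft_inversion {g : (Fin n → ℝ) → ℂ} (hg : Integrable g) (hg' : Integrable (ft g)) :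
    (fun t => (1 / (2 * (π : ℂ)) ^ n) * ∫ x, expI (-t) x * ft g x) =ᵐ[volume] g := by
  have h2 : Integrable (𝓕 fun v : EuclideanSpace ℝ (Fin n) => g v.ofLp) := by
    rw [show (𝓕 fun v : EuclideanSpace ℝ (Fin n) => g v.ofLp) =
      fun v => ft g (-(2 * π) • v.ofLp) from funext (fourier_comp_ofLp g),
      integrable_comp_ofLp (g := fun x => ft g (-(2 * π) • x))]
    exact hg'.comp_smul (by simp [Real.pi_ne_zero])
  have h := fourierInv_fourier_ae_eq (integrable_comp_ofLp.2 hg) h2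
  have h' := (PiLp.volume_preserving_toLp (Fin n)).quasiMeasurePreserving.ae h
  filter_upwards [h'] with t ht
  rw [← ht, Real.fourierInv_eq', ← integral_comp_two_pi_smul_ofLp]
  congr 1 with w
  rw [fourier_comp_ofLp, smul_eq_mul, expI]
  congr 2
  simp only [PiLp.inner_apply, RCLike.inner_apply, conj_trivial, Pi.smul_apply, smul_eq_mul,
    Pi.neg_apply]
  push_cast
  rw [Finset.mul_sum, Finset.mul_sum, Finset.sum_mul]
  exact Finset.sum_congr rfl fun j _ => by ring

/-- The bilinear form of Parseval's identity, for `ft`. -/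
lemma integral_ft_mul_ft_neg {f g : (Fin n → ℝ) → ℂ} (hf : Integrable f) (hf2 : MemLp f 2 volume)
    (hg : Integrable g) (hg2 : MemLp g 2 volume) :
    (1 / (2 * (π : ℂ)) ^ n) * ∫ x, ft f x * ft g (-x) = ∫ x, f x * g x := by
  have h := integral_fourier_mul_fourier_neg (integrable_comp_ofLp.2 hf) (memLp_comp_ofLp hf2)
    (integrable_comp_ofLp.2 hg) (memLp_comp_ofLp hg2)
  rw [(PiLp.volume_preserving_ofLp (Fin n)).integral_comp
    (MeasurableEquiv.toLp 2 (Fin n → ℝ)).symm.measurableEmbedding (fun x => f x * g x)] at h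
  rw [← h, ← integral_comp_two_pi_smul_ofLp]
  simp [fourier_comp_ofLp]

/-- Plancherel's identity for `ft`; only that the constant is nonzero and finite matters. -/
lemma exists_lintegral_ft_sq (n : ℕ) : ∃ C : ENNReal, C ≠ 0 ∧ C ≠ ⊤ ∧
    ∀ g : (Fin n → ℝ) → ℂ, Integrable g → MemLp g 2 volume →
      ∫⁻ x, ‖ft g x‖ₑ ^ 2 = C * ∫⁻ t, ‖g t‖ₑ ^ 2 := by
  refine ⟨ENNReal.ofReal |(-(2 * π)) ^ n|, by simp [Real.pi_ne_zero], ENNReal.ofReal_ne_top,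
    fun g hg hg2 => ?_⟩
  have h := eLpNorm_fourier (integrable_comp_ofLp.2 hg) (memLp_comp_ofLp hg2)
  rw [eLpNorm_eq_lintegral_rpow_enorm_toReal two_ne_zero ENNReal.ofNat_ne_top,
    eLpNorm_eq_lintegral_rpow_enorm_toReal two_ne_zero ENNReal.ofNat_ne_top] at h
  replace h := ENNReal.rpow_left_injective (by norm_num) h
  simp only [ENNReal.toReal_ofNat, ENNReal.rpow_ofNat, fourier_comp_ofLp] at h
  rw [(PiLp.volume_preserving_ofLp (Fin n)).lintegral_comp_emb
    (MeasurableEquiv.toLp 2 (Fin n → ℝ)).symm.measurableEmbedding (fun x => ‖g x‖ₑ ^ 2),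
    (PiLp.volume_preserving_ofLp (Fin n)).lintegral_comp_emb
    (MeasurableEquiv.toLp 2 (Fin n → ℝ)).symm.measurableEmbedding
      (fun x => ‖ft g (-(2 * π) • x)‖ₑ ^ 2)] at h
  have hm := Measure.map_addHaar_smul (volume : Measure (Fin n → ℝ))
    (r := -(2 * π)) (by simp [Real.pi_ne_zero])
  have hl : ∫⁻ x, ‖ft g (-(2 * π) • x)‖ₑ ^ 2 =
      ∫⁻ x, ‖ft g x‖ₑ ^ 2 ∂(Measure.map (fun x => -(2 * π) • x) volume) := by
    rw [lintegral_map _ (by fun_prop)]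
    have := continuous_ft hg
    exact Measurable.pow_const this.enorm.measurable 2
  rw [← h, hl, hm, lintegral_smul_measure, smul_eq_mul, ← mul_assoc,
    ← ENNReal.ofReal_mul (abs_nonneg _), ← abs_mul]
  simp [Real.pi_ne_zero]

end Coordinates

/-! ### Polynomial decay in the `L²` sense -/

section Decay

/-- `(1 + ‖z‖)^m H(z)` is square integrable. With `m = n + 1` on `ℝ²ⁿ`, an `L²` function `H` lies in
`𝒱(ℝ²ⁿ)` exactly when both `H` and its Fourier transform decay in this sense. -/
def Decay {V : Type*} [NormedAddCommGroup V] [MeasureSpace V] (m : ℕ) (H : V → ℂ) : Prop :=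
  MemLp (fun z => (((1 + ‖z‖) ^ m : ℝ) : ℂ) * H z) 2 volume

lemma one_add_norm_pow_ne_zero {V : Type*} [NormedAddCommGroup V] (m : ℕ) (z : V) :
    (((1 + ‖z‖) ^ m : ℝ) : ℂ) ≠ 0 := by
  have : 0 < (1 + ‖z‖) ^ m := by positivity
  exact_mod_cast this.ne'

lemma enorm_one_add_norm_pow_mul {V : Type*} [NormedAddCommGroup V] (m : ℕ) (z : V) (c : ℂ) :
    ‖(((1 + ‖z‖) ^ m : ℝ) : ℂ) * c‖ₑ = ENNReal.ofReal ((1 + ‖z‖) ^ m) * ‖c‖ₑ := by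
  have h : ‖(((1 + ‖z‖) ^ m : ℝ) : ℂ)‖ₑ = ENNReal.ofReal ((1 + ‖z‖) ^ m) := by
    rw [← ofReal_norm, Complex.norm_real, Real.norm_of_nonneg (by positivity)]
  rw [enorm_mul, h]

variable {V : Type*} [NormedAddCommGroup V] [MeasureSpace V] {m : ℕ} {H H' : V → ℂ}

lemma Decay.congr_ae (h : Decay m H) (e : H =ᵐ[volume] H') : Decay m H' := by
  refine (memLp_congr_ae ?_).1 h
  filter_upwards [e] with z hz
  rw [hz]

lemma Decay.const_mul (h : Decay m H) (c : ℂ) : Decay m (fun z => c * H z) := by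
  have := MemLp.const_mul h c
  refine (memLp_congr_ae (ae_of_all _ fun z => ?_)).1 this
  ring

lemma Decay.lintegral_lt_top (h : Decay m H) :
    ∫⁻ z, (ENNReal.ofReal ((1 + ‖z‖) ^ m) * ‖H z‖ₑ) ^ 2 < ⊤ := by
  have := h.2
  rw [eLpNorm_lt_top_iff_lintegral_rpow_enorm_lt_top two_ne_zero ENNReal.ofNat_ne_top] at this
  convert this using 3 with z
  rw [enorm_one_add_norm_pow_mul]
  simp

section Borel

variable [BorelSpace V]

lemma Decay.aestronglyMeasurable (h : Decay m H) : AEStronglyMeasurable H volume := by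
  have h1 : Continuous fun z : V => ((((1 + ‖z‖) ^ m : ℝ) : ℂ))⁻¹ :=
    Continuous.inv₀ (by fun_prop) (one_add_norm_pow_ne_zero m)
  refine (h1.measurable.aestronglyMeasurable.mul h.1).congr (ae_of_all _ fun z => ?_)
  have := one_add_norm_pow_ne_zero m z
  simp only [Pi.mul_apply]
  field_simp

lemma Decay.of_lintegral_lt_top (hm : AEStronglyMeasurable H volume)
    (h : ∫⁻ z, (ENNReal.ofReal ((1 + ‖z‖) ^ m) * ‖H z‖ₑ) ^ 2 < ⊤) : Decay m H := by
  refine ⟨Continuous.aestronglyMeasurable (f := fun z : V => (((1 + ‖z‖) ^ m : ℝ) : ℂ))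
    (by fun_prop) |>.mul hm, ?_⟩
  rw [eLpNorm_lt_top_iff_lintegral_rpow_enorm_lt_top two_ne_zero ENNReal.ofNat_ne_top]
  convert h using 3 with z
  rw [enorm_one_add_norm_pow_mul]
  simp

lemma Decay.memLp (h : Decay m H) : MemLp H 2 volume := by
  refine MemLp.mono h h.aestronglyMeasurable (ae_of_all _ fun z => ?_)
  rw [norm_mul, Complex.norm_real, Real.norm_of_nonneg (by positivity)]
  have : 1 ≤ (1 + ‖z‖) ^ m := one_le_pow₀ (by simp)
  nlinarith [norm_nonneg (H z)]

/-- The part of the decay condition that is not already square integrability. -/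
lemma Decay.of_norm_pow (h : MemLp H 2 volume)
    (h' : MemLp (fun z => ((‖z‖ ^ m : ℝ) : ℂ) * H z) 2 volume) : Decay m H := by
  have h3 := (h.norm.add h'.norm).const_mul ((2 : ℝ) ^ m)
  refine h3.mono (Continuous.aestronglyMeasurable (f := fun z : V => (((1 + ‖z‖) ^ m : ℝ) : ℂ))
    (by fun_prop) |>.mul h.1) (ae_of_all _ fun z => ?_)
  simp only [norm_mul, Complex.norm_real, Pi.add_apply]
  rw [Real.norm_of_nonneg (by positivity : 0 ≤ (1 + ‖z‖) ^ m),
    Real.norm_of_nonneg (by positivity : 0 ≤ (2 : ℝ) ^ m),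
    Real.norm_of_nonneg (by positivity : 0 ≤ ‖H z‖ + ‖‖z‖ ^ m‖ * ‖H z‖),
    Real.norm_of_nonneg (by positivity : 0 ≤ ‖z‖ ^ m)]
  have h4 : (1 + ‖z‖) ^ m ≤ 2 ^ m * (1 + ‖z‖ ^ m) := by
    have := add_pow_le (zero_le_one) (norm_nonneg z) m
    refine this.trans ?_
    rw [one_pow]
    gcongr
    · norm_num
    · omega
  calc (1 + ‖z‖) ^ m * ‖H z‖ ≤ 2 ^ m * (1 + ‖z‖ ^ m) * ‖H z‖ := by gcongr
    _ = _ := by ring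

end Borel

section Linear

variable [NormedSpace ℝ V] [FiniteDimensional ℝ V] [BorelSpace V]
  [(volume : Measure V).IsAddHaarMeasure]

lemma Decay.integrable (h : Decay m H) (hm : Module.finrank ℝ V < 2 * m) : Integrable H := by
  have h1 : MemLp (fun z : V => ((((1 + ‖z‖) ^ m : ℝ) : ℂ))⁻¹) 2 volume := by
    have hc : Continuous fun z : V => ((((1 + ‖z‖) ^ m : ℝ) : ℂ))⁻¹ :=
      Continuous.inv₀ (by fun_prop) (one_add_norm_pow_ne_zero m)
    rw [← memLp_norm_iff hc.aestronglyMeasurable, memLp_two_iff_integrable_sq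
      hc.norm.aestronglyMeasurable]
    have := integrable_one_add_norm (μ := (volume : Measure V)) (r := ((2 * m : ℕ) : ℝ))
      (by exact_mod_cast hm)
    refine this.congr (ae_of_all _ fun z => ?_)
    have hz : 0 < 1 + ‖z‖ := by positivity
    simp only
    rw [Real.rpow_neg hz.le, Real.rpow_natCast, norm_inv, Complex.norm_real,
      Real.norm_of_nonneg (by positivity), inv_pow, ← pow_mul, mul_comm]
  refine (h1.integrable_mul h).congr (ae_of_all _ fun z => ?_)
  have := one_add_norm_pow_ne_zero m z
  simp only [Pi.mul_apply]
  field_simp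

variable {V' : Type*} [NormedAddCommGroup V'] [NormedSpace ℝ V']
  [MeasureSpace V'] [BorelSpace V'] [(volume : Measure V').IsAddHaarMeasure]

lemma exists_map_volume_eq_smul (L : V' ≃L[ℝ] V) :
    ∃ c : NNReal, Measure.map L (volume : Measure V') = c • (volume : Measure V) := by
  have : (Measure.map L (volume : Measure V')).IsAddHaarMeasure := L.isAddHaarMeasure_map volume
  exact ⟨_, Measure.isAddLeftInvariant_eq_smul _ _⟩

lemma quasiMeasurePreserving_linear (L : V' ≃L[ℝ] V) :
    Measure.QuasiMeasurePreserving L (volume : Measure V') (volume : Measure V) := by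
  obtain ⟨c, hc⟩ := exists_map_volume_eq_smul L
  exact ⟨L.continuous.measurable, by rw [hc]; exact Measure.smul_absolutelyContinuous⟩

/-- Decay is invariant under linear changes of variables. -/
lemma Decay.comp (h : Decay m H) (L : V' ≃L[ℝ] V) : Decay m (H ∘ L) := by
  obtain ⟨c, hmap⟩ := exists_map_volume_eq_smul L
  have hqm := quasiMeasurePreserving_linear L
  have h1 : MemLp ((fun z => (((1 + ‖z‖) ^ m : ℝ) : ℂ) * H z) ∘ L) 2 volume := by
    rw [← memLp_map_measure_iff _ L.continuous.aemeasurable, hmap]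
    · exact MemLp.smul_measure h ENNReal.coe_ne_top
    · rw [hmap]
      exact h.1.mono_ac Measure.smul_absolutelyContinuous
  obtain ⟨C, hC0, hC⟩ := (L.symm : V →L[ℝ] V').bound
  refine (h1.const_mul (((1 + C) ^ m : ℝ) : ℂ)).mono ?_ (ae_of_all _ fun z => ?_)
  · exact (Continuous.aestronglyMeasurable (f := fun z : V' => (((1 + ‖z‖) ^ m : ℝ) : ℂ))
      (by fun_prop)).mul (h.aestronglyMeasurable.comp_quasiMeasurePreserving hqm)
  · simp only [Function.comp_apply, norm_mul, Complex.norm_real]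
    rw [Real.norm_of_nonneg (by positivity), Real.norm_of_nonneg (by positivity),
      Real.norm_of_nonneg (by positivity), ← mul_assoc, ← mul_pow]
    gcongr
    have := hC (L z)
    simp only [ContinuousLinearEquiv.coe_coe, ContinuousLinearEquiv.symm_apply_apply] at this
    nlinarith [norm_nonneg (L z)]

end Linear
end Decay

/-! ### Partial Fourier transforms -/

section PartialTransform

variable {n : ℕ}

/-- The Fourier integral in the first of two blocks of `n` variables. -/
def pft (H : (Fin n → ℝ) × (Fin n → ℝ) → ℂ) (z : (Fin n → ℝ) × (Fin n → ℝ)) : ℂ :=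
  ft (fun a => H (a, z.2)) z.1

/-- The Fourier integral in both blocks of variables, on `ℝⁿ × ℝⁿ`. -/
def ft2 (H : (Fin n → ℝ) × (Fin n → ℝ) → ℂ) (z : (Fin n → ℝ) × (Fin n → ℝ)) : ℂ :=
  ∫ p : (Fin n → ℝ) × (Fin n → ℝ), expI z.1 p.1 * (expI z.2 p.2 * H p)

instance : (volume : Measure ((Fin n → ℝ) × (Fin n → ℝ))).IsAddHaarMeasure :=
  Measure.prod.instIsAddHaarMeasure _ _

variable {H : (Fin n → ℝ) × (Fin n → ℝ) → ℂ}

lemma Decay.integrable_prod (h : Decay (n + 1) H) : Integrable H :=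
  h.integrable (by simp; omega)

lemma MeasureTheory.MemLp.ae_slice_fst {F : (Fin n → ℝ) × (Fin n → ℝ) → ℂ} (hF : MemLp F 2 volume) :
    ∀ᵐ x, MemLp (fun b => F (x, b)) 2 volume := by
  have h1 := ((memLp_two_iff_integrable_sq_norm hF.1).1 hF).prod_right_ae
  filter_upwards [h1, hF.1.prodMk_left] with x hx hx'
  exact (memLp_two_iff_integrable_sq_norm hx').2 hx

lemma MeasureTheory.MemLp.ae_slice_snd {F : (Fin n → ℝ) × (Fin n → ℝ) → ℂ} (hF : MemLp F 2 volume) :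
    ∀ᵐ b, MemLp (fun a => F (a, b)) 2 volume :=
  MemLp.ae_slice_fst (F := F ∘ Prod.swap) (hF.comp_measurePreserving Measure.measurePreserving_swap)

lemma aestronglyMeasurable_pft (hH : AEStronglyMeasurable H volume) :
    AEStronglyMeasurable (pft H) volume := by
  refine AEStronglyMeasurable.integral_prod_right'
    (f := fun w : ((Fin n → ℝ) × (Fin n → ℝ)) × (Fin n → ℝ) =>
      expI w.1.1 w.2 * H (w.2, w.1.2)) (AEStronglyMeasurable.mul ?_ ?_)
  · exact Continuous.aestronglyMeasurable (by fun_prop)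
  · exact hH.prod_swap.comp_quasiMeasurePreserving
      (QuasiMeasurePreserving.prodMap Measure.quasiMeasurePreserving_snd
        (Measure.QuasiMeasurePreserving.id volume))

lemma integrable_pft_right (hH : Integrable H) (x : Fin n → ℝ) :
    Integrable fun b => pft H (x, b) :=
  (Integrable.expI_mul hH (f := fun _ => x) (g := Prod.fst) continuous_const
    continuous_fst).integral_prod_right

/-- The full Fourier integral is an iterated one. -/
lemma ft_pft (hH : Integrable H) (x y : Fin n → ℝ) :
    ft (fun b => pft H (x, b)) y = ft2 H (x, y) := by
  have h : Integrable fun p : (Fin n → ℝ) × (Fin n → ℝ) => expI x p.1 * (expI y p.2 * H p) :=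
    (hH.expI_mul continuous_const continuous_snd).expI_mul continuous_const continuous_fst
  rw [ft2, Measure.volume_eq_prod, integral_prod_symm _ h]
  simp only [ft, pft, ← integral_const_mul]
  congr 1 with b
  congr 1 with a
  ring

lemma continuous_ft2 (hH : Integrable H) : Continuous (ft2 H) := by
  refine continuous_of_dominated (bound := fun p => ‖H p‖) (fun z => ?_) (fun z => ?_) hH.norm ?_
  · exact ((hH.expI_mul continuous_const continuous_snd).expI_mul continuous_const
      continuous_fst).1
  · exact ae_of_all _ fun t => by simp [norm_expI]
  · exact ae_of_all _ fun t => by fun_prop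

lemma aemeasurable_weight_mul_enorm_sq {G : (Fin n → ℝ) × (Fin n → ℝ) → ℂ}
    {w : (Fin n → ℝ) × (Fin n → ℝ) → ℝ} (hw : Continuous w) (hG : AEStronglyMeasurable G volume) :
    AEMeasurable (fun z => (ENNReal.ofReal (w z) * ‖G z‖ₑ) ^ 2) volume :=
  (hw.measurable.ennreal_ofReal.aemeasurable.mul hG.enorm).pow_const 2

lemma Decay.of_lintegral_coords {G : (Fin n → ℝ) × (Fin n → ℝ) → ℂ} {m : ℕ}
    (hG : AEStronglyMeasurable G volume)
    (h1 : ∫⁻ z, (ENNReal.ofReal ((1 + ‖z.1‖) ^ m) * ‖G z‖ₑ) ^ 2 < ⊤)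
    (h2 : ∫⁻ z, (ENNReal.ofReal ((1 + ‖z.2‖) ^ m) * ‖G z‖ₑ) ^ 2 < ⊤) : Decay m G := by
  refine Decay.of_lintegral_lt_top hG (lt_of_le_of_lt (lintegral_mono fun z => ?_) (?_ :
    ∫⁻ z, ((ENNReal.ofReal ((1 + ‖z.1‖) ^ m) * ‖G z‖ₑ) ^ 2 +
      (ENNReal.ofReal ((1 + ‖z.2‖) ^ m) * ‖G z‖ₑ) ^ 2) < ⊤))
  · rcases le_total ‖z.1‖ ‖z.2‖ with h | h
    · rw [Prod.norm_def, max_eq_right h]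
      exact le_add_self
    · rw [Prod.norm_def, max_eq_left h]
      exact le_self_add
  · rw [lintegral_add_left']
    · exact ENNReal.add_lt_top.2 ⟨h1, h2⟩
    · exact aemeasurable_weight_mul_enorm_sq (w := fun z => (1 + ‖z.1‖) ^ m) (by fun_prop) hG

/-- The partial Fourier transform of a kernel of `𝒱(ℝ²ⁿ)` is again in the space, at least as far as
decay is concerned. The decay in the untransformed variables and, for the transformed ones, that of
the full transform are each carried over by Plancherel's identity in the other variables. -/
lemma Decay.pft (h : Decay (n + 1) H) (h' : Decay (n + 1) (ft2 H)) : Decay (n + 1) (pft H) := by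
  obtain ⟨C, hC0, hC, hP⟩ := exists_lintegral_ft_sq n
  have hint := h.integrable_prod
  have hm := aestronglyMeasurable_pft h.aestronglyMeasurable
  have h2 : ∫⁻ z, (ENNReal.ofReal ((1 + ‖z.2‖) ^ (n + 1)) * ‖_root_.pft H z‖ₑ) ^ 2 < ⊤ := by
    rw [Measure.volume_eq_prod, lintegral_prod_symm _
      (aemeasurable_weight_mul_enorm_sq (w := fun z => (1 + ‖z.2‖) ^ (n + 1)) (by fun_prop)
        hm)]
    refine lt_of_eq_of_lt (b := C * ∫⁻ z, (ENNReal.ofReal ((1 + ‖z.2‖) ^ (n + 1)) * ‖H z‖ₑ) ^ 2)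
      ?_ (ENNReal.mul_lt_top hC.lt_top (lt_of_le_of_lt (lintegral_mono fun z => ?_)
        h.lintegral_lt_top))
    · rw [Measure.volume_eq_prod, lintegral_prod_symm _
        (aemeasurable_weight_mul_enorm_sq (w := fun z => (1 + ‖z.2‖) ^ (n + 1)) (by fun_prop)
        h.aestronglyMeasurable),
        ← lintegral_const_mul' _ _ hC]
      refine lintegral_congr_ae ?_
      filter_upwards [hint.prod_left_ae, h.memLp.ae_slice_snd] with b hb hb'
      simp only [mul_pow]
      rw [lintegral_const_mul' _ _ (by finiteness), lintegral_const_mul' _ _ (by finiteness)]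
      simp only [_root_.pft]
      rw [hP _ hb hb', mul_left_comm]
    · gcongr
      exact norm_snd_le z
  -- square integrability of the slices `G(x, ·)` is needed for Plancherel's identity in `b`
  have hL2 : MemLp (_root_.pft H) 2 volume := by
    refine ⟨hm, ?_⟩
    rw [eLpNorm_lt_top_iff_lintegral_rpow_enorm_lt_top two_ne_zero ENNReal.ofNat_ne_top]
    refine lt_of_le_of_lt (lintegral_mono fun z => ?_) h2
    simp only [ENNReal.toReal_ofNat, ENNReal.rpow_ofNat]
    gcongr
    refine le_mul_of_one_le_left' ?_
    rw [ENNReal.one_le_ofReal]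
    exact one_le_pow₀ (by simp)
  refine Decay.of_lintegral_coords hm ?_ h2
  have h1 : C * ∫⁻ z, (ENNReal.ofReal ((1 + ‖z.1‖) ^ (n + 1)) * ‖_root_.pft H z‖ₑ) ^ 2 =
      ∫⁻ z, (ENNReal.ofReal ((1 + ‖z.1‖) ^ (n + 1)) * ‖ft2 H z‖ₑ) ^ 2 := by
    rw [Measure.volume_eq_prod, lintegral_prod _
      (aemeasurable_weight_mul_enorm_sq (w := fun z => (1 + ‖z.1‖) ^ (n + 1)) (by fun_prop)
        hm), lintegral_prod _
      (aemeasurable_weight_mul_enorm_sq (w := fun z => (1 + ‖z.1‖) ^ (n + 1)) (by fun_prop)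
        h'.aestronglyMeasurable),
      ← lintegral_const_mul' _ _ hC]
    refine lintegral_congr_ae ?_
    filter_upwards [hL2.ae_slice_fst] with x hx
    simp only [mul_pow]
    rw [lintegral_const_mul' _ _ (by finiteness), lintegral_const_mul' _ _ (by finiteness),
      mul_left_comm, ← hP _ (integrable_pft_right hint x) hx]
    simp only [ft_pft hint]
  have h3 : ∫⁻ z, (ENNReal.ofReal ((1 + ‖z.1‖) ^ (n + 1)) * ‖ft2 H z‖ₑ) ^ 2 < ⊤ := by
    refine lt_of_le_of_lt (lintegral_mono fun z => ?_) h'.lintegral_lt_top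
    gcongr
    exact norm_fst_le z
  rw [← h1] at h3
  exact ENNReal.lt_top_of_mul_ne_top_right h3.ne hC0

end PartialTransform

/-! ### Blockwise linear maps and polar coordinates with signed radius -/

section ChangeOfVariables

variable {n : ℕ}

/-- The linear map acting on the `j`-th pair of coordinates of `ℝⁿ × ℝⁿ` as the matrix
`!![a j, b j; c j, d j]` of determinant `a j * d j - b j * c j ≠ 0`. -/
def blockEquiv (a b c d : Fin n → ℝ) (h : ∀ j, a j * d j - b j * c j ≠ 0) :
    ((Fin n → ℝ) × (Fin n → ℝ)) ≃L[ℝ] ((Fin n → ℝ) × (Fin n → ℝ)) :=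
  LinearEquiv.toContinuousLinearEquiv
    { toFun := fun z => (a * z.1 + b * z.2, c * z.1 + d * z.2)
      invFun := fun z => (fun j => (d j * z.1 j - b j * z.2 j) / (a j * d j - b j * c j),
        fun j => (a j * z.2 j - c j * z.1 j) / (a j * d j - b j * c j))
      map_add' := fun z w => by ext j <;> simp [mul_add] <;> abel
      map_smul' := fun r z => by ext j <;> simp
      left_inv := fun z => by
        ext j
        · have := h j
          simp only [Pi.add_apply, Pi.mul_apply]
          rw [div_eq_iff this]
          ring
        · have := h j
          simp only [Pi.add_apply, Pi.mul_apply]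
          rw [div_eq_iff this]
          ring
      right_inv := fun z => by
        ext j
        · have := h j
          simp only [Pi.add_apply, Pi.mul_apply]
          rw [← mul_div_assoc, ← mul_div_assoc, ← add_div, div_eq_iff this]
          ring
        · have := h j
          simp only [Pi.add_apply, Pi.mul_apply]
          rw [← mul_div_assoc, ← mul_div_assoc, ← add_div, div_eq_iff this]
          ring }

@[simp]
lemma blockEquiv_apply (a b c d : Fin n → ℝ) (h : ∀ j, a j * d j - b j * c j ≠ 0)
    (z : (Fin n → ℝ) × (Fin n → ℝ)) :
    blockEquiv a b c d h z = (a * z.1 + b * z.2, c * z.1 + d * z.2) := rfl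

lemma measurePreserving_plane (a b c d : ℝ) (h : |a * d - b * c| = 1) :
    MeasurePreserving fun p : ℝ × ℝ => (a * p.1 + b * p.2, c * p.1 + d * p.2) := by
  set L : ℝ × ℝ →ₗ[ℝ] ℝ × ℝ :=
    Matrix.toLin (.finTwoProd ℝ) (.finTwoProd ℝ) !![a, b; c, d] with hL
  have hdet : LinearMap.det L = a * d - b * c := by
    rw [hL, LinearMap.det_toLin, Matrix.det_fin_two_of]
  have hL' : (fun p : ℝ × ℝ => (a * p.1 + b * p.2, c * p.1 + d * p.2)) = L := by
    ext p <;> simp [hL, Matrix.toLin_finTwoProd_apply]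
  have hne : LinearMap.det L ≠ 0 := by
    rw [hdet]
    intro h0
    simp [h0] at h
  refine ⟨by fun_prop, ?_⟩
  rw [hL', Measure.map_linearMap_addHaar_eq_smul_addHaar _ hne, hdet, abs_inv, h]
  simp

lemma measurePreserving_blockEquiv (a b c d : Fin n → ℝ) (h : ∀ j, a j * d j - b j * c j ≠ 0)
    (h' : ∀ j, |a j * d j - b j * c j| = 1) : MeasurePreserving (blockEquiv a b c d h) := by
  have h1 := volume_measurePreserving_arrowProdEquivProdArrow ℝ ℝ (Fin n)
  have h2 := volume_preserving_pi fun j => measurePreserving_plane (a j) (b j) (c j) (d j) (h' j)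
  exact (h1.comp h2).comp h1.symm

/-- Half of the angles with radii of both signs cover the punctured plane once. -/
lemma injOn_polarCoord_symm_signed :
    Set.InjOn polarCoord.symm {p : ℝ × ℝ | p.1 ≠ 0 ∧ p.2 ∈ Set.Ioo 0 π} := by
  rintro ⟨r, θ⟩ ⟨hr, hθ⟩ ⟨s, φ⟩ ⟨hs, hφ⟩ h
  simp only [polarCoord_symm_apply, Prod.mk.injEq] at h hr hs hθ hφ ⊢
  obtain ⟨h1, h2⟩ := h
  -- points on the lines at angles `θ` and `φ` agree only if the lines do, as both lie in `(0, π)`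
  have hdet : r * Real.sin (θ - φ) = 0 := by
    rw [Real.sin_sub]
    have e1 : Real.sin φ * (r * Real.cos θ) = Real.sin φ * (s * Real.cos φ) := by rw [h1]
    have e2 : Real.cos φ * (r * Real.sin θ) = Real.cos φ * (s * Real.sin φ) := by rw [h2]
    linear_combination e2 - e1
  have h3 : Real.sin (θ - φ) = 0 := (mul_eq_zero.1 hdet).resolve_left hr
  have h4 : θ - φ = 0 := by
    by_contra hne
    exact hne ((Real.sin_eq_zero_iff_of_lt_of_lt (by linarith [hθ.1, hφ.2])
      (by linarith [hθ.2, hφ.1])).1 h3)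
  have h5 : θ = φ := by linarith
  subst h5
  exact ⟨mul_right_cancel₀ (Real.sin_pos_of_pos_of_lt_pi hθ.1 hθ.2).ne' h2, rfl⟩

lemma subset_image_polarCoord_symm_signed :
    {p : ℝ × ℝ | p.2 ≠ 0} ⊆
      polarCoord.symm '' {p : ℝ × ℝ | p.1 ≠ 0 ∧ p.2 ∈ Set.Ioo 0 π} := by
  have key : ∀ x y : ℝ, 0 < y → ∃ r θ : ℝ, r ≠ 0 ∧ θ ∈ Set.Ioo 0 π ∧ r * Real.cos θ = x ∧
      r * Real.sin θ = y := by
    intro x y hy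
    have hz : (⟨x, y⟩ : ℂ) ≠ 0 := fun h => hy.ne' (congrArg Complex.im h)
    refine ⟨‖(⟨x, y⟩ : ℂ)‖, Complex.arg ⟨x, y⟩, norm_ne_zero_iff.2 hz, ⟨?_, ?_⟩, ?_, ?_⟩
    · refine lt_of_le_of_ne (Complex.arg_nonneg_iff.2 hy.le) fun h => ?_
      exact hy.ne' (Complex.arg_eq_zero_iff.1 h.symm).2
    · exact Complex.arg_lt_pi_iff.2 (Or.inr hy.ne')
    · exact Complex.norm_mul_cos_arg _
    · exact Complex.norm_mul_sin_arg _
  rintro ⟨x, y⟩ hy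
  rcases lt_or_gt_of_ne (show y ≠ 0 from hy) with h | h
  · obtain ⟨r, θ, hr, hθ, h1, h2⟩ := key (-x) (-y) (by linarith)
    exact ⟨(-r, θ), ⟨neg_ne_zero.2 hr, hθ⟩, by ext <;> simp <;> linarith⟩
  · obtain ⟨r, θ, hr, hθ, h1, h2⟩ := key x y h
    exact ⟨(r, θ), ⟨hr, hθ⟩, by ext <;> simp [h1, h2]⟩

/-- The map `(α, l) ↦ (l cos α, l sin α)`, of Jacobian `∏ |l j|`. -/
def polarMap (a : (Fin n → ℝ) × (Fin n → ℝ)) : (Fin n → ℝ) × (Fin n → ℝ) :=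
  (mulCos a.2 a.1, mulSin a.2 a.1)

/-- The set of all `(l j, α j)` with `l j ≠ 0` and `0 < α j < π`, on which polar coordinates with
signed radius are injective. -/
def signedPolarSet (n : ℕ) : Set (Fin n → ℝ × ℝ) :=
  Set.univ.pi fun _ => {p : ℝ × ℝ | p.1 ≠ 0 ∧ p.2 ∈ Set.Ioo 0 π}

lemma measurableSet_signedPolarSet (n : ℕ) : MeasurableSet (signedPolarSet n) := by
  refine MeasurableSet.univ_pi fun _ => ?_
  exact (measurable_fst (measurableSet_singleton 0).compl).inter (measurable_snd measurableSet_Ioo)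

lemma ae_snd_ne_zero : ∀ᵐ p : ℝ × ℝ, p.2 ≠ 0 := by
  have : ∀ᵐ y : ℝ, y ≠ 0 := by simp [ae_iff]
  exact Measure.quasiMeasurePreserving_snd.ae this

lemma image_signedPolarSet_ae_eq_univ :
    ((fun p (i : Fin n) => polarCoord.symm (p i)) '' signedPolarSet n) =ᵐ[volume] Set.univ := by
  change (Pi.map (fun _ : Fin n => polarCoord.symm) '' _) =ᵐ[volume] _
  rw [signedPolarSet, Set.piMap_image_univ_pi, volume_pi, ← Set.pi_univ Set.univ]
  refine Measure.ae_eq_set_pi fun _ _ => ?_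
  rw [ae_eq_univ]
  exact measure_mono_null (Set.compl_subset_compl.2 subset_image_polarCoord_symm_signed)
    ae_snd_ne_zero

lemma injOn_signedPolarSet :
    Set.InjOn (fun p (i : Fin n) => polarCoord.symm (p i)) (signedPolarSet n) :=
  fun _ hx _ hy h => funext fun i =>
    injOn_polarCoord_symm_signed (hx i trivial) (hy i trivial) (congrFun h i)

/-- The swap `(α, l) ↦ (l j, α j)_j`, up to which `polarMap` is Mathlib's `polarCoord.symm` in each
pair of coordinates. -/
def pairSwap (n : ℕ) : ((Fin n → ℝ) × (Fin n → ℝ)) ≃ᵐ (Fin n → ℝ × ℝ) :=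
  MeasurableEquiv.prodComm.trans (MeasurableEquiv.arrowProdEquivProdArrow ℝ ℝ (Fin n)).symm

lemma measurePreserving_pairSwap (n : ℕ) : MeasurePreserving (pairSwap n) :=
  (volume_measurePreserving_arrowProdEquivProdArrow ℝ ℝ (Fin n)).symm.comp
    Measure.measurePreserving_swap

lemma angleBox_prod_ae_eq :
    (angleBox n ×ˢ Set.univ : Set ((Fin n → ℝ) × (Fin n → ℝ))) =ᵐ[volume]
      pairSwap n ⁻¹' signedPolarSet n := by
  have h1 : ∀ᵐ p : (Fin n → ℝ) × (Fin n → ℝ), ∀ j, p.2 j ≠ 0 ∧ p.1 j ≠ 0 ∧ p.1 j ≠ π := by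
    have hx : ∀ c : ℝ, ∀ᵐ x : Fin n → ℝ, ∀ j, x j ≠ c := fun c => by
      rw [ae_all_iff]
      intro j
      have : ∀ᵐ y : ℝ, y ≠ c := by simp [ae_iff]
      exact (Measure.quasiMeasurePreserving_eval (fun _ : Fin n => (volume : Measure ℝ)) j).ae this
    filter_upwards [Measure.quasiMeasurePreserving_snd.ae (hx 0),
      Measure.quasiMeasurePreserving_fst.ae (hx 0), Measure.quasiMeasurePreserving_fst.ae (hx π)]
      with p h1 h2 h3 j using ⟨h1 j, h2 j, h3 j⟩
  filter_upwards [h1] with p hp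
  refine propext ?_
  change p ∈ angleBox n ×ˢ Set.univ ↔ p ∈ pairSwap n ⁻¹' signedPolarSet n
  simp only [angleBox, Set.mem_prod, Set.mem_Icc, Pi.le_def, Set.mem_univ, and_true,
    Set.mem_preimage, signedPolarSet, Set.mem_univ_pi]
  constructor
  · rintro ⟨h2, h3⟩ j
    exact ⟨(hp j).1, lt_of_le_of_ne (h2 j) (hp j).2.1.symm, lt_of_le_of_ne (h3 j) (hp j).2.2⟩
  · intro h
    exact ⟨fun j => (h j).2.1.le, fun j => (h j).2.2.le⟩

/-- The Jacobian of polar coordinates with signed radius, pulled back by `pairSwap`. -/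
lemma abs_det_polar (p : (Fin n → ℝ) × (Fin n → ℝ)) :
    |(fderivPiPolarCoordSymm (pairSwap n p)).det| = ∏ j, |p.2 j| := by
  rw [det_fderivPiPolarCoordSymm, Finset.abs_prod]
  rfl

variable {E : Type*} [NormedAddCommGroup E] [NormedSpace ℝ E]

lemma integrableOn_polarMap {F : (Fin n → ℝ) × (Fin n → ℝ) → E} (hF : Integrable F) :
    IntegrableOn (fun a => (∏ j, |a.2 j|) • F (polarMap a)) (angleBox n ×ˢ Set.univ) := by
  have e := volume_measurePreserving_arrowProdEquivProdArrow ℝ ℝ (Fin n)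
  have h0 : Integrable fun p : Fin n → ℝ × ℝ =>
      F (MeasurableEquiv.arrowProdEquivProdArrow ℝ ℝ (Fin n) p) :=
    (e.integrable_comp_emb (MeasurableEquiv.measurableEmbedding _)).2 hF
  have h1 := (integrableOn_image_iff_integrableOn_abs_det_fderiv_smul volume
    (measurableSet_signedPolarSet n)
    (fun p _ => (hasFDerivAt_pi_polarCoord_symm p).hasFDerivWithinAt) injOn_signedPolarSet
    _).1 h0.integrableOn
  rw [integrableOn_congr_set_ae angleBox_prod_ae_eq]
  have h2 := ((measurePreserving_pairSwap n).integrableOn_comp_preimage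
    (pairSwap n).measurableEmbedding).2 h1
  refine h2.congr (ae_of_all _ fun p => ?_)
  simp only [Function.comp_apply, abs_det_polar]
  rfl

lemma setIntegral_polarMap (F : (Fin n → ℝ) × (Fin n → ℝ) → E) :
    ∫ a : (Fin n → ℝ) × (Fin n → ℝ) in angleBox n ×ˢ Set.univ,
      (∏ j, |a.2 j|) • F (polarMap a) = ∫ z, F z := by
  have e := volume_measurePreserving_arrowProdEquivProdArrow ℝ ℝ (Fin n)
  rw [← e.integral_comp (MeasurableEquiv.measurableEmbedding _) F,
    ← setIntegral_univ (X := Fin n → ℝ × ℝ),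
    ← setIntegral_congr_set image_signedPolarSet_ae_eq_univ,
    integral_image_eq_integral_abs_det_fderiv_smul volume (measurableSet_signedPolarSet n)
      (fun p _ => (hasFDerivAt_pi_polarCoord_symm p).hasFDerivWithinAt) injOn_signedPolarSet,
    setIntegral_congr_set angleBox_prod_ae_eq,
    ← (measurePreserving_pairSwap n).setIntegral_preimage_emb
      (pairSwap n).measurableEmbedding]
  simp only [abs_det_polar]
  rfl

end ChangeOfVariables

/-! ### Admissible functions and the space `𝒱(ℝ²ⁿ)` -/

section Admissible

variable {n : ℕ}

/-- `H` and its Fourier transform decay: the form in which membership in `𝒱(ℝ²ⁿ)` is used. -/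
def Admissible (H : (Fin n → ℝ) × (Fin n → ℝ) → ℂ) : Prop :=
  Decay (n + 1) H ∧ Decay (n + 1) (ft2 H)

lemma expI_mul_expI (x y p q : Fin n → ℝ) :
    expI x p * expI y q = Complex.exp (Complex.I * ((∑ j, (x j * p j + y j * q j) : ℝ) : ℂ)) := by
  rw [expI, expI, ← Complex.exp_add, ← mul_add, Finset.sum_add_distrib, Complex.ofReal_add]

/-- Fourier transform of a function composed with a linear map `A`, where `B` is the inverse of the
transpose of `A`. -/
lemma ft2_comp (H : (Fin n → ℝ) × (Fin n → ℝ) → ℂ)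
    (A B : ((Fin n → ℝ) × (Fin n → ℝ)) ≃L[ℝ] ((Fin n → ℝ) × (Fin n → ℝ)))
    (hA : MeasurePreserving A)
    (hAB : ∀ z p, ∑ j, ((B z).1 j * (A p).1 j + (B z).2 j * (A p).2 j) =
      ∑ j, (z.1 j * p.1 j + z.2 j * p.2 j)) :
    ft2 (H ∘ A) = ft2 H ∘ B := by
  ext z
  simp only [Function.comp_apply, ft2]
  rw [← hA.integral_comp A.toHomeomorph.measurableEmbedding
    (fun p => expI (B z).1 p.1 * (expI (B z).2 p.2 * H p))]
  congr 1 with p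
  rw [← mul_assoc, ← mul_assoc, expI_mul_expI, expI_mul_expI, hAB]

lemma Admissible.comp {H : (Fin n → ℝ) × (Fin n → ℝ) → ℂ} (h : Admissible H)
    (A B : ((Fin n → ℝ) × (Fin n → ℝ)) ≃L[ℝ] ((Fin n → ℝ) × (Fin n → ℝ)))
    (hA : MeasurePreserving A)
    (hAB : ∀ z p, ∑ j, ((B z).1 j * (A p).1 j + (B z).2 j * (A p).2 j) =
      ∑ j, (z.1 j * p.1 j + z.2 j * p.2 j)) : Admissible (H ∘ A) :=
  ⟨h.1.comp A, by rw [ft2_comp H A B hA hAB]; exact h.2.comp B⟩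

/-- The rotation of each plane of coordinates `(x j, y j)` by the angle `α j`. -/
def rot (α : Fin n → ℝ) : ((Fin n → ℝ) × (Fin n → ℝ)) ≃L[ℝ] ((Fin n → ℝ) × (Fin n → ℝ)) :=
  blockEquiv (fun j => Real.cos (α j)) (fun j => -Real.sin (α j)) (fun j => Real.sin (α j))
    (fun j => Real.cos (α j)) (fun j => by
      have := Real.sin_sq_add_cos_sq (α j)
      intro h
      nlinarith)

lemma rot_apply (α : Fin n → ℝ) (z : (Fin n → ℝ) × (Fin n → ℝ)) :
    rot α z = (fun j => Real.cos (α j) * z.1 j - Real.sin (α j) * z.2 j,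
      fun j => Real.sin (α j) * z.1 j + Real.cos (α j) * z.2 j) := by
  ext j <;> simp [rot, sub_eq_add_neg]

lemma measurePreserving_rot (α : Fin n → ℝ) : MeasurePreserving (rot α) := by
  refine measurePreserving_blockEquiv _ _ _ _ _ fun j => ?_
  rw [show Real.cos (α j) * Real.cos (α j) - -Real.sin (α j) * Real.sin (α j) = 1 by
    linear_combination Real.sin_sq_add_cos_sq (α j), abs_one]

lemma sum_rot_mul_rot (α : Fin n → ℝ) (z p : (Fin n → ℝ) × (Fin n → ℝ)) :
    ∑ j, ((rot α z).1 j * (rot α p).1 j + (rot α z).2 j * (rot α p).2 j) =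
      ∑ j, (z.1 j * p.1 j + z.2 j * p.2 j) := by
  refine Finset.sum_congr rfl fun j _ => ?_
  simp only [rot_apply]
  linear_combination (z.1 j * p.1 j + z.2 j * p.2 j) * Real.sin_sq_add_cos_sq (α j)

lemma ft2_comp_rot (H : (Fin n → ℝ) × (Fin n → ℝ) → ℂ) (α : Fin n → ℝ) :
    ft2 (H ∘ rot α) = ft2 H ∘ rot α :=
  ft2_comp H _ _ (measurePreserving_rot α) (sum_rot_mul_rot α)

lemma Admissible.comp_rot {H : (Fin n → ℝ) × (Fin n → ℝ) → ℂ} (h : Admissible H)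
    (α : Fin n → ℝ) : Admissible (H ∘ rot α) :=
  h.comp _ _ (measurePreserving_rot α) (sum_rot_mul_rot α)

/-- The map `(t, y) ↦ (t + y/2, t - y/2)` from the centre and difference variables to `(q, q')`. -/
def centerMap (n : ℕ) : ((Fin n → ℝ) × (Fin n → ℝ)) ≃L[ℝ] ((Fin n → ℝ) × (Fin n → ℝ)) :=
  blockEquiv (fun _ => 1) (fun _ => 1 / 2) (fun _ => 1) (fun _ => -(1 / 2)) (fun _ => by norm_num)

lemma centerMap_apply (z : (Fin n → ℝ) × (Fin n → ℝ)) :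
    centerMap n z = (z.1 + (1 / 2 : ℝ) • z.2, z.1 - (1 / 2 : ℝ) • z.2) := by
  ext j <;> simp [centerMap, sub_eq_add_neg]

lemma measurePreserving_centerMap (n : ℕ) : MeasurePreserving (centerMap n) :=
  measurePreserving_blockEquiv _ _ _ _ _ fun _ => by norm_num

lemma Admissible.comp_centerMap {H : (Fin n → ℝ) × (Fin n → ℝ) → ℂ} (h : Admissible H) :
    Admissible (H ∘ centerMap n) := by
  refine h.comp _ (blockEquiv (fun _ => 1 / 2) (fun _ => 1) (fun _ => 1 / 2) (fun _ => -1)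
    fun _ => by norm_num) (measurePreserving_centerMap n) fun z p => ?_
  refine Finset.sum_congr rfl fun j _ => ?_
  simp only [centerMap_apply, blockEquiv_apply, Pi.add_apply, Pi.mul_apply, Pi.sub_apply,
    Pi.smul_apply, smul_eq_mul]
  ring

/-- `ℝⁿ × ℝⁿ` as the Euclidean space `ℝ²ⁿ`. -/
def prodEquivEuclidean (n : ℕ) :
    ((Fin n → ℝ) × (Fin n → ℝ)) ≃ₗ[ℝ] EuclideanSpace ℝ (Fin n ⊕ Fin n) :=
  (LinearEquiv.sumArrowLequivProdArrow (Fin n) (Fin n) ℝ ℝ).symm.trans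
    (WithLp.linearEquiv 2 ℝ (Fin n ⊕ Fin n → ℝ)).symm

lemma prodEquivEuclidean_inl (z : (Fin n → ℝ) × (Fin n → ℝ)) (j : Fin n) :
    prodEquivEuclidean n z (Sum.inl j) = z.1 j := rfl

lemma prodEquivEuclidean_inr (z : (Fin n → ℝ) × (Fin n → ℝ)) (j : Fin n) :
    prodEquivEuclidean n z (Sum.inr j) = z.2 j := rfl

lemma measurePreserving_prodEquivEuclidean (n : ℕ) :
    MeasurePreserving (prodEquivEuclidean n) :=
  (PiLp.volume_preserving_toLp (Fin n ⊕ Fin n)).comp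
    (volume_measurePreserving_sumPiEquivProdPi_symm fun _ : Fin n ⊕ Fin n => ℝ)

lemma ft2_kernel (ρ : (Fin n → ℝ) → (Fin n → ℝ) → ℂ) (z : (Fin n → ℝ) × (Fin n → ℝ)) :
    ft2 (fun p => ρ p.1 p.2) z = 𝓕 (kernelFun ρ) (prodEquivEuclidean n (-(2 * π)⁻¹ • z)) := by
  rw [Real.fourier_eq', ← (measurePreserving_prodEquivEuclidean n).integral_comp
    (prodEquivEuclidean n).toContinuousLinearEquiv.toHomeomorph.measurableEmbedding, ft2]
  congr 1 with p
  rw [← mul_assoc, expI_mul_expI, smul_eq_mul, mul_comm Complex.I]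
  congr 4
  simp only [PiLp.inner_apply, RCLike.inner_apply, conj_trivial, Fintype.sum_sum_type,
    prodEquivEuclidean_inl, prodEquivEuclidean_inr, Prod.smul_fst, Prod.smul_snd, Pi.smul_apply,
    smul_eq_mul]
  rw [← Finset.sum_add_distrib, Finset.mul_sum]
  refine Finset.sum_congr rfl fun j _ => ?_
  field_simp
  ring

/-- Membership in `𝒱(ℝ²ⁿ)` in terms of Fourier integrals instead of the transform of `L²`. -/
lemma MemV.admissible {ρ : (Fin n → ℝ) → (Fin n → ℝ) → ℂ} (hρ : MemV ρ) :
    Admissible fun p => ρ p.1 p.2 := by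
  obtain ⟨h, h1, g, h2, h3⟩ := hρ
  have hd : Decay (n + 1) (kernelFun ρ) := by
    refine Decay.of_norm_pow h ((memLp_congr_ae ?_).1 h2)
    rw [h3]
    filter_upwards [h.coeFn_toLp] with z hz
    rw [hz]
  have hint : Integrable (kernelFun ρ) := hd.integrable (by simp; omega)
  have hd' : Decay (n + 1) (𝓕 (kernelFun ρ)) := by
    refine Decay.of_norm_pow (memLp_fourier hint h) ((memLp_congr_ae ?_).1 h1)
    filter_upwards [fourier_toLp_ae_eq hint h] with z hz
    rw [hz]
  have hc : -(2 * π)⁻¹ ≠ 0 := by simp [Real.pi_ne_zero]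
  refine ⟨hd.comp (prodEquivEuclidean n).toContinuousLinearEquiv, ?_⟩
  rw [show ft2 (fun p : (Fin n → ℝ) × (Fin n → ℝ) => ρ p.1 p.2) = _ from funext (ft2_kernel ρ)]
  exact hd'.comp ((LinearEquiv.smulOfNeZero ℝ _ _ hc).trans
    (prodEquivEuclidean n)).toContinuousLinearEquiv

end Admissible

/-! ### The Wigner function -/

section Wigner

variable {n : ℕ}

lemma ae_eq_of_ae_ae_eq {F G : (Fin n → ℝ) × (Fin n → ℝ) → ℂ}
    (hF : AEStronglyMeasurable F volume) (hG : AEStronglyMeasurable G volume)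
    (h : ∀ᵐ x, ∀ᵐ y, F (x, y) = G (x, y)) : F =ᵐ[volume] G := by
  have h1 : hF.mk F =ᵐ[volume] hG.mk G := by
    refine (Measure.ae_prod_iff_ae_ae
      (measurableSet_eq_fun hF.stronglyMeasurable_mk.measurable
        hG.stronglyMeasurable_mk.measurable)).2 ?_
    filter_upwards [h, Measure.ae_ae_of_ae_prod hF.ae_eq_mk, Measure.ae_ae_of_ae_prod hG.ae_eq_mk]
      with x h1 h2 h3
    filter_upwards [h1, h2, h3] with y h1 h2 h3
    rw [← h2, ← h3, h1]
  exact hF.ae_eq_mk.trans (h1.trans hG.ae_eq_mk.symm)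

/-- The Wigner function `(2π)⁻ⁿ ∫ e^{-i p·y} r(t, y) dy` of a kernel `r` given in centre and
difference variables. -/
def wigner (r : (Fin n → ℝ) × (Fin n → ℝ) → ℂ) (z : (Fin n → ℝ) × (Fin n → ℝ)) : ℂ :=
  (1 / (2 * (π : ℂ)) ^ n) * ft (fun y => r (z.1, -y)) z.2

/-- Exchange of the two blocks, with a sign, as a rotation by `-π/2`. -/
lemma rot_neg_half_pi (z : (Fin n → ℝ) × (Fin n → ℝ)) :
    rot (fun _ : Fin n => -(π / 2)) z = (z.2, -z.1) := by
  ext j <;> simp [rot_apply]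

lemma measurePreserving_swap_vec (n : ℕ) :
    MeasurePreserving (Prod.swap : (Fin n → ℝ) × (Fin n → ℝ) → (Fin n → ℝ) × (Fin n → ℝ)) :=
  Measure.measurePreserving_swap

lemma wigner_eq (r : (Fin n → ℝ) × (Fin n → ℝ) → ℂ) :
    wigner r = fun z => (1 / (2 * (π : ℂ)) ^ n) *
      (pft (r ∘ rot fun _ : Fin n => -(π / 2)) ∘ ContinuousLinearEquiv.prodComm ℝ _ _) z := by
  ext z
  simp [wigner, pft, rot_neg_half_pi]

variable {r : (Fin n → ℝ) × (Fin n → ℝ) → ℂ}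

lemma Admissible.decay_wigner (h : Admissible r) : Decay (n + 1) (wigner r) := by
  rw [wigner_eq]
  have h' := h.comp_rot fun _ : Fin n => -(π / 2)
  exact ((h'.1.pft h'.2).comp (ContinuousLinearEquiv.prodComm ℝ _ _)).const_mul _

/-- The full Fourier integral as an iterated one, the inner one being over the second block. -/
lemma ft_ft_snd {H : (Fin n → ℝ) × (Fin n → ℝ) → ℂ} (hH : Integrable H) (x y : Fin n → ℝ) :
    ft (fun a => ft (fun b => H (a, b)) y) x = ft2 H (x, y) := by
  have h : Integrable fun p : (Fin n → ℝ) × (Fin n → ℝ) => expI x p.1 * (expI y p.2 * H p) :=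
    (hH.expI_mul continuous_const continuous_snd).expI_mul continuous_const continuous_fst
  rw [ft2, Measure.volume_eq_prod, integral_prod _ h]
  simp only [ft, ← integral_const_mul]

lemma aestronglyMeasurable_ft_snd {H : (Fin n → ℝ) × (Fin n → ℝ) → ℂ}
    (hH : AEStronglyMeasurable H volume) :
    AEStronglyMeasurable (fun z : (Fin n → ℝ) × (Fin n → ℝ) => ft (fun b => H (z.1, b)) z.2)
      volume :=
  AEStronglyMeasurable.integral_prod_right'
    (f := fun w : ((Fin n → ℝ) × (Fin n → ℝ)) × (Fin n → ℝ) => expI w.1.2 w.2 * H (w.1.1, w.2))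
    ((Continuous.aestronglyMeasurable (by fun_prop)).mul
      (hH.comp_quasiMeasurePreserving (QuasiMeasurePreserving.prodMap
        Measure.quasiMeasurePreserving_fst (Measure.QuasiMeasurePreserving.id volume))))

/-- Inverting the transform that defines the Wigner function. -/
lemma Admissible.ft_wigner_ae_eq (h : Admissible r) :
    (fun z : (Fin n → ℝ) × (Fin n → ℝ) => ft (fun p => wigner r (z.1, p)) z.2) =ᵐ[volume] r := by
  refine ae_eq_of_ae_ae_eq ?_ h.1.aestronglyMeasurable ?_
  · exact aestronglyMeasurable_ft_snd h.decay_wigner.aestronglyMeasurable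
  · have hc : (1 / (2 * (π : ℂ)) ^ n) ≠ 0 := by simp [Real.pi_ne_zero]
    filter_upwards [h.1.integrable_prod.prod_right_ae,
      h.decay_wigner.integrable_prod.prod_right_ae] with t h1 h2
    -- this is `W(t, ·)` up to the constant
    have h3 : Integrable (ft fun y => r (t, -y)) := by
      refine (h2.const_mul (1 / (2 * (π : ℂ)) ^ n)⁻¹).congr (ae_of_all _ fun p => ?_)
      simp only [wigner]
      rw [inv_mul_cancel_left₀ hc]
    have h4 := (Measure.measurePreserving_neg (volume : Measure (Fin n → ℝ)))
      |>.quasiMeasurePreserving.ae (ft_inversion h1.comp_neg h3)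
    filter_upwards [h4] with y hy
    rw [neg_neg] at hy
    rw [← hy, ft, ← integral_const_mul]
    congr 1 with p
    simp only [wigner]
    ring

/-- The Fourier transform of the Wigner function is the characteristic function. -/
lemma Admissible.ft2_wigner (h : Admissible r) :
    ∀ᵐ y, ∀ x, ft2 (wigner r) (x, y) = pft r (x, y) := by
  have h1 := Measure.ae_ae_of_ae_prod
    ((measurePreserving_swap_vec n).quasiMeasurePreserving.ae h.ft_wigner_ae_eq)
  filter_upwards [h1] with y hy x
  rw [← ft_ft_snd h.decay_wigner.integrable_prod, pft]
  exact congrFun (ft_congr_ae hy) x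

lemma Admissible.wigner (h : Admissible r) : Admissible (wigner r) := by
  refine ⟨h.decay_wigner, (h.1.pft h.2).congr_ae ?_⟩
  have h1 : ∀ᵐ y : Fin n → ℝ, ∀ᵐ x : Fin n → ℝ,
      (_root_.pft r ∘ Prod.swap) (y, x) = (ft2 (_root_.wigner r) ∘ Prod.swap) (y, x) := by
    filter_upwards [h.ft2_wigner] with y hy
    exact ae_of_all _ fun x => (hy x).symm
  have h2 := ae_eq_of_ae_ae_eq
    ((aestronglyMeasurable_pft h.1.aestronglyMeasurable).comp_measurePreserving
      (measurePreserving_swap_vec n))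
    ((continuous_ft2 h.decay_wigner.integrable_prod).aestronglyMeasurable.comp_measurePreserving
      (measurePreserving_swap_vec n)) h1
  exact (measurePreserving_swap_vec n).quasiMeasurePreserving.ae h2

end Wigner

/-! ### Marginals and slices -/

section Radon

variable {n : ℕ}

/-- The marginal of `W` along the planes rotated by `α`, a Radon transform. -/
def marginal (W : (Fin n → ℝ) × (Fin n → ℝ) → ℂ) (α : Fin n → ℝ) (a : Fin n → ℝ) : ℂ :=
  ∫ b, W (rot α (a, b))

variable {W : (Fin n → ℝ) × (Fin n → ℝ) → ℂ}

lemma Admissible.integrable_marginal (h : Admissible W) (α : Fin n → ℝ) :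
    Integrable (marginal W α) :=
  (h.comp_rot α).1.integrable_prod.integral_prod_left

/-- The projection-slice identity. -/
lemma Admissible.ft_marginal (h : Admissible W) (α l : Fin n → ℝ) :
    ft (marginal W α) l = ft2 W (mulCos l α, mulSin l α) := by
  have h1 := ft_ft_snd (h.comp_rot α).1.integrable_prod l 0
  rw [ft2_comp_rot] at h1
  have h2 : rot α (l, 0) = (mulCos l α, mulSin l α) := by
    ext j <;> simp [rot_apply, mulCos, mulSin, mul_comm]
  rw [Function.comp_apply, h2] at h1
  rw [← h1]
  congr 1 with a
  simp [marginal, ft, expI]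

/-- The slices of the transform are integrable: the slice at angle `α` is the marginal of a partial
transform of the rotated function, which is integrable on the whole of `ℝ²ⁿ`. -/
lemma Admissible.integrable_ft_marginal (h : Admissible W) (α : Fin n → ℝ) :
    Integrable (ft (marginal W α)) := by
  have hr := h.comp_rot α
  refine ((hr.1.pft hr.2).integrable_prod.integral_prod_left).congr (ae_of_all _ fun x => ?_)
  -- the value at `y = 0` of the transform in `b` is the integral over `b`
  have h1 := ft_pft hr.1.integrable_prod x 0
  rw [← ft_ft_snd hr.1.integrable_prod x 0] at h1
  simpa [marginal, ft, expI] using h1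

end Radon

/-! ### Tomograms -/

section Tomogram

variable {n : ℕ} {ρ : (Fin n → ℝ) → (Fin n → ℝ) → ℂ}

/-- The kernel in centre and difference variables `(t, y)`. -/
def centered (ρ : (Fin n → ℝ) → (Fin n → ℝ) → ℂ) (z : (Fin n → ℝ) × (Fin n → ℝ)) : ℂ :=
  ρ (z.1 + (1 / 2 : ℝ) • z.2) (z.1 - (1 / 2 : ℝ) • z.2)

lemma MemV.admissible_centered (h : MemV ρ) : Admissible (centered ρ) := by
  have := h.admissible.comp_centerMap
  convert this using 1
  ext z
  simp [centered, centerMap_apply]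

lemma charFn_eq (x y : Fin n → ℝ) : charFn ρ x y = pft (centered ρ) (x, y) := rfl

lemma ae_sin_ne_zero (n : ℕ) : ∀ᵐ α : Fin n → ℝ, ∀ j, Real.sin (α j) ≠ 0 := by
  rw [ae_all_iff]
  intro j
  have h : ∀ᵐ y : ℝ, Real.sin y ≠ 0 := by
    have hc : {y : ℝ | Real.sin y = 0}.Countable := by
      refine (Set.countable_range fun k : ℤ => (k : ℝ) * π).mono fun y hy => ?_
      exact Real.sin_eq_zero_iff.1 hy
    simpa [ae_iff] using hc.measure_zero volume
  exact (Measure.quasiMeasurePreserving_eval (fun _ : Fin n => (volume : Measure ℝ)) j).ae h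

/-- Off the directions `sin (α j) = 0`, the null set of `y` where the characteristic function
depends on the representative of `ρ` meets the plane at angle `α` in a null set. -/
lemma MemV.charFn_slice_ae_eq (h : MemV ρ) {α : Fin n → ℝ} (hα : ∀ j, Real.sin (α j) ≠ 0) :
    (fun t => charFn ρ (mulCos t α) (mulSin t α)) =ᵐ[volume]
      ft (marginal (wigner (centered ρ)) α) := by
  let L : (Fin n → ℝ) ≃L[ℝ] (Fin n → ℝ) :=
    (LinearEquiv.piCongrRight fun j =>
      LinearEquiv.smulOfNeZero ℝ ℝ (Real.sin (α j)) (hα j)).toContinuousLinearEquiv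
  have hL : ∀ t, L t = mulSin t α := fun t => by
    ext j
    simp [L, mulSin, mul_comm]
  filter_upwards [(quasiMeasurePreserving_linear L).ae h.admissible_centered.ft2_wigner] with t ht
  rw [hL] at ht
  rw [charFn_eq, ← ht, h.admissible_centered.wigner.ft_marginal]

lemma MemV.integrable_charFn_slice (h : MemV ρ) {α : Fin n → ℝ}
    (hα : ∀ j, Real.sin (α j) ≠ 0) :
    Integrable fun t => charFn ρ (mulCos t α) (mulSin t α) :=
  (h.admissible_centered.wigner.integrable_ft_marginal α).congr (h.charFn_slice_ae_eq hα).symm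

lemma MemV.tomogramConverges (h : MemV ρ) : TomogramConverges ρ :=
  ⟨h.admissible_centered.1.integrable_prod.prod_left_ae, by
    filter_upwards [ae_sin_ne_zero n] with α hα using h.integrable_charFn_slice hα⟩

/-- The tomogram is the marginal of the Wigner function. -/
lemma MemV.tomogram_ae_eq (h : MemV ρ) {α : Fin n → ℝ} (hα : ∀ j, Real.sin (α j) ≠ 0) :
    (fun x => tomogram ρ x α) =ᵐ[volume] marginal (wigner (centered ρ)) α := by
  have hW := h.admissible_centered.wigner
  refine Filter.EventuallyEq.trans (ae_of_all _ fun x => ?_)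
    (ft_inversion (hW.integrable_marginal α) (hW.integrable_ft_marginal α))
  simp only [tomogram]
  congr 1
  refine integral_congr_ae ?_
  filter_upwards [h.charFn_slice_ae_eq hα] with t ht
  rw [ht]

lemma MemV.integrable_tomogram (h : MemV ρ) {α : Fin n → ℝ} (hα : ∀ j, Real.sin (α j) ≠ 0) :
    Integrable fun x => tomogram ρ x α :=
  (h.admissible_centered.wigner.integrable_marginal α).congr (h.tomogram_ae_eq hα).symm

lemma MemV.ft_tomogram (h : MemV ρ) {α : Fin n → ℝ} (hα : ∀ j, Real.sin (α j) ≠ 0)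
    (l : Fin n → ℝ) :
    ft (fun x => tomogram ρ x α) l = ft2 (wigner (centered ρ)) (mulCos l α, mulSin l α) := by
  rw [ft_congr_ae (h.tomogram_ae_eq hα), h.admissible_centered.wigner.ft_marginal]

end Tomogram

/-! ### The transition probability -/

section Overlap

variable {n : ℕ} {ρ₁ ρ₂ : (Fin n → ℝ) → (Fin n → ℝ) → ℂ}

lemma pairIntegrand_eq (α l : Fin n → ℝ) :
    pairIntegrand ρ₁ ρ₂ α l = fun p =>
      (expI l p.1 * tomogram ρ₁ p.1 α) * (expI (-l) p.2 * tomogram ρ₂ p.2 α) := by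
  ext p
  rw [pairIntegrand, sub_eq_add_neg, expI_add_right, expI_neg_right]
  ring

lemma MemV.integrable_pairIntegrand (h₁ : MemV ρ₁) (h₂ : MemV ρ₂) {α : Fin n → ℝ}
    (hα : ∀ j, Real.sin (α j) ≠ 0) (l : Fin n → ℝ) : Integrable (pairIntegrand ρ₁ ρ₂ α l) := by
  rw [pairIntegrand_eq]
  exact ((h₁.integrable_tomogram hα).expI_mul continuous_const continuous_id).mul_prod
    ((h₂.integrable_tomogram hα).expI_mul continuous_const continuous_id)

lemma MemV.outerIntegrand_eq (h₁ : MemV ρ₁) (h₂ : MemV ρ₂)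
    {a : (Fin n → ℝ) × (Fin n → ℝ)} (ha : ∀ j, Real.sin (a.1 j) ≠ 0) :
    outerIntegrand ρ₁ ρ₂ a = (∏ j, |a.2 j|) • (ft2 (wigner (centered ρ₁)) (polarMap a) *
      ft2 (wigner (centered ρ₂)) (-polarMap a)) := by
  have hneg : (mulCos (-a.2) a.1, mulSin (-a.2) a.1) = -polarMap a := by
    ext j <;> simp [mulCos, mulSin, polarMap]
  rw [outerIntegrand, pairIntegrand_eq, Measure.volume_eq_prod, Complex.real_smul,
    integral_prod_mul (fun x => expI a.2 x * tomogram ρ₁ x a.1)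
      (fun x => expI (-a.2) x * tomogram ρ₂ x a.1), ← hneg, ← h₂.ft_tomogram ha, polarMap,
    ← h₁.ft_tomogram ha]
  rfl

lemma Admissible.integrable_mul_neg {W₁ W₂ : (Fin n → ℝ) × (Fin n → ℝ) → ℂ} (h₁ : Admissible W₁)
    (h₂ : Admissible W₂) : Integrable fun z => ft2 W₁ z * ft2 W₂ (-z) :=
  h₁.2.memLp.integrable_mul
    (h₂.2.memLp.comp_measurePreserving
      ((Measure.measurePreserving_neg volume).prod (Measure.measurePreserving_neg volume)))

/-- Parseval's identity in the first variable, for almost every value of the second. -/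
lemma MemV.integral_ft2_wigner_mul (h₁ : MemV ρ₁) (h₂ : MemV ρ₂) :
    (1 / (2 * (π : ℂ)) ^ n) * ∫ z, ft2 (wigner (centered ρ₁)) z * ft2 (wigner (centered ρ₂)) (-z) =
      transProb ρ₁ ρ₂ := by
  have a₁ := h₁.admissible_centered
  have a₂ := h₂.admissible_centered
  have hneg := (Measure.measurePreserving_neg (volume : Measure (Fin n → ℝ)))
    |>.quasiMeasurePreserving
  have hint : Integrable fun z : (Fin n → ℝ) × (Fin n → ℝ) =>
      centered ρ₁ z * centered ρ₂ (z.1, -z.2) := by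
    refine MemLp.integrable_mul (q := 2) a₁.1.memLp ?_
    exact a₂.1.memLp.comp_measurePreserving
      ((MeasurePreserving.id volume).prod (Measure.measurePreserving_neg volume))
  have e : transProb ρ₁ ρ₂ = ∫ z : (Fin n → ℝ) × (Fin n → ℝ),
      centered ρ₁ z * centered ρ₂ (z.1, -z.2) := by
    rw [transProb, ← (measurePreserving_centerMap n).integral_comp
      (centerMap n).toHomeomorph.measurableEmbedding]
    congr 1 with z
    simp [centerMap_apply, centered, sub_eq_add_neg]
  rw [e, Measure.volume_eq_prod, integral_prod_symm _ (a₁.wigner.integrable_mul_neg a₂.wigner),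
    integral_prod_symm _ hint, ← integral_const_mul]
  refine integral_congr_ae ?_
  filter_upwards [a₁.ft2_wigner, hneg.ae a₂.ft2_wigner, a₁.1.integrable_prod.prod_left_ae,
    hneg.ae a₂.1.integrable_prod.prod_left_ae, a₁.1.memLp.ae_slice_snd,
    hneg.ae a₂.1.memLp.ae_slice_snd] with y e₁ e₂ i₁ i₂ m₁ m₂
  rw [← integral_ft_mul_ft_neg i₁ m₁ i₂ m₂]
  congr 2 with x
  rw [e₁, Prod.neg_mk, e₂]
  rfl

end Overlap

theorem theorem2 (n : ℕ) (ρ₁ ρ₂ : (Fin n → ℝ) → (Fin n → ℝ) → ℂ)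
    (h₁ : MemV ρ₁) (h₂ : MemV ρ₂) :
    TomogramConverges ρ₁ ∧ TomogramConverges ρ₂ ∧
    Integrable (fun p : (Fin n → ℝ) × (Fin n → ℝ) => ρ₁ p.1 p.2 * ρ₂ p.2 p.1) ∧
    (∀ᵐ α : Fin n → ℝ, ∀ l : Fin n → ℝ, Integrable (pairIntegrand ρ₁ ρ₂ α l)) ∧
    IntegrableOn (outerIntegrand ρ₁ ρ₂) (angleBox n ×ˢ Set.univ) ∧
    transProb ρ₁ ρ₂ =
      (1 / (2 * (π : ℂ)) ^ n) * ∫ a in angleBox n ×ˢ Set.univ, outerIntegrand ρ₁ ρ₂ a := by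
  have hae : ∀ᵐ a : (Fin n → ℝ) × (Fin n → ℝ), outerIntegrand ρ₁ ρ₂ a =
      (∏ j, |a.2 j|) • (ft2 (wigner (centered ρ₁)) (polarMap a) *
        ft2 (wigner (centered ρ₂)) (-polarMap a)) := by
    filter_upwards [Measure.quasiMeasurePreserving_fst.ae (ae_sin_ne_zero n)] with a ha
      using h₁.outerIntegrand_eq h₂ ha
  refine ⟨h₁.tomogramConverges, h₂.tomogramConverges, ?_, ?_, ?_, ?_⟩
  · exact h₁.admissible.1.memLp.integrable_mul
      (h₂.admissible.1.memLp.comp_measurePreserving (measurePreserving_swap_vec n))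
  · filter_upwards [ae_sin_ne_zero n] with α hα l using h₁.integrable_pairIntegrand h₂ hα l
  · exact (integrableOn_polarMap (h₁.admissible_centered.wigner.integrable_mul_neg
      h₂.admissible_centered.wigner)).congr (ae_restrict_of_ae (hae.mono fun _ h => h.symm))
  · rw [← h₁.integral_ft2_wigner_mul h₂, integral_congr_ae (ae_restrict_of_ae hae),
      setIntegral_polarMap fun z => ft2 (wigner (centered ρ₁)) z * ft2 (wigner (centered ρ₂)) (-z)]

end
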